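/- **Definitions.** A changing alphabet is a sequence $X=(X_i)_{i\ge 1}$ of non-empty finite sets; it is *unbounded* if the sequence $(|X_i|)_{i\ge1}$ is unbounded. $X^*$ is the set of finite words $x_1x_2\ldots x_t$ ($t\ge 0$) with $x_i\in X_i$. An automaton $A=(X,Q,\varphi,\psi)$ over $X$ is a finite set $Q$ of states with functions $\varphi_i\colon Q\times X_i\to Q$ and $\psi_i\colon Q\times X_i\to X_i$ ($i\ge1$). For $q\in Q$ the map $A_q\colon X^*\to X^*$ is given by $$A_q(x_1\ldots x_t)=\psi_1(q_1,x_1)\ldots\psi_t(q_t,x_t),\qquad q_1=q,\quad q_{i+1}=\varphi_i(q_i,x_i).$$ $A$ is *invertible* if every $\sigma_{i,q}\colon x\mapsto\psi_i(q,x)$ is a permutation of $X_i$; then its inverse automaton $A^{-1}$ has the transition functions $(q,x)\mapsto\varphi_i(q,\sigma_{i,q}^{-1}(x))$ and the output functions $(q,x)\mapsto\sigma_{i,q}^{-1}(x)$, each $A_q$ is a permutation of $X^*$, and $G(A)=\langle A_q\colon q\in Q\rangle\le \mathrm{Sym}(X^*)$. $A$ is *reversible* if for all $i$ and all $x\in X_i$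 the map $q\mapsto\varphi_i(q,x)$ is a permutation of $Q$, and *bi-reversible* if it is invertible and both $A$ and $A^{-1}$ are reversible. **Theorem.** Let $X=(X_i)_{i\ge1}$ be an unbounded changing alphabet. 1. There is a strictly increasing sequence $\xi=(\xi_i)_{i\ge1}$ of positive integers such that the changing alphabet $Y=(Y_i)_{i\ge 1}$, $Y_i:=X_{\xi_i}$, is unbounded, the sequence $(|Y_i|)_{i\ge1}$ is non-decreasing, and $|Y_i|\ge2$ for all $i$. 2. Let $\xi$ be any such sequence. Then for every $i\ge1$ there are letters $x_i^0,x_i^1\in Y_i$, a transposition $\tau_i\in \mathrm{Sym}(Y_i)$ and a long cycle $\pi_i\in \mathrm{Sym}(Y_i)$ (a cycle of length $|Y_i|$) with $\tau_i(x_i^0)=\pi_i(x_i^0)=x_i^1$. For any such choice, let $A=(Y,\{q_1,q_2\},\varphi,\psi)$ be the automaton with two distinct states in which $\varphi_i(q,x)=q$ if $x\ne x_i^0$, $\varphi_i(q_1,x_i^0)=q_2$, $\varphi_i(q_2,x_i^0)=q_1$, $\psi_i(q_1,x)=\pi_i(x)$ and $\psi_i(q_2,x)=\tau_i(x)$. Let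 $B=(X,\{q_1,q_2\},\varphi',\psi')$ be the automaton with $$\varphi'_{\xi_j}=\varphi_j,\quad \psi'_{\xi_j}=\psi_j\quad(j\ge1),\qquad \varphi'_i(q,x)=q,\quad \psi'_i(q,x)=x\quad\text{if } i\notin\{\xi_j\colon j\ge1\}.$$ Then the two-state automaton $B$ is bi-reversible, and the group $G(B)$ is isomorphic to the free group $\mathcal F_2$ of rank $2$. -/

import Mathlib

/-! Alphabets `X = (X_i)` and all other sequences are indexed by `ℕ` starting from `0`, so the
`i`-th term here is the `(i+1)`-st term in the numbering that starts from `1`. -/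

universe u v

/-- The changing alphabet `X` is unbounded: the cardinalities `|X_i|` are not bounded. -/
def UnboundedAlphabet (X : ℕ → Type u) : Prop :=
  ¬ BddAbove (Set.range fun i => Nat.card (X i))

/-- The tree `X^*` of finite words `x_0 x_1 … x_{t-1}` with `x_i ∈ X_i` (`t = 0` gives the empty
word). -/
def WordTree (X : ℕ → Type u) : Type u :=
  Σ t : ℕ, (i : Fin t) → X i

/-- An automaton over the changing alphabet `X` with finite set of states `Q`:
transition functions `φ_i : Q × X_i → Q` and output functions `ψ_i : Q × X_i → X_i`. -/
structure Automaton (X : ℕ → Type u) (Q : Type v) [Finite Q] where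
  trans : (i : ℕ) → Q → X i → Q
  out : (i : ℕ) → Q → X i → X i

namespace Automaton

variable {X : ℕ → Type u} {Q : Type v} [Finite Q]

/-- The state in which the automaton is before it reads the letter number `k` of `w`, if it starts
in the state `q`. -/
def stateAt (A : Automaton X Q) (q : Q) {t : ℕ} (w : (i : Fin t) → X i) : (k : ℕ) → k ≤ t → Q
  | 0, _ => q
  | k + 1, h => A.trans k (A.stateAt q w k (Nat.le_of_succ_le h)) (w ⟨k, h⟩)

/-- The output word `ψ_0(q_0, x_0) ψ_1(q_1, x_1) …` of `A` started in the state `q` on the word `w`,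
where `q_k` is the state before reading the letter number `k`. -/
def outWord (A : Automaton X Q) (q : Q) {t : ℕ} (w : (i : Fin t) → X i) : (i : Fin t) → X i :=
  fun i => A.out i (A.stateAt q w i i.2.le) (w i)

/-- The transformation `A_q : X^* → X^*`. -/
def act (A : Automaton X Q) (q : Q) (w : WordTree X) : WordTree X :=
  ⟨w.1, A.outWord q w.2⟩

/-- `A` is invertible: all labelings `σ_{i,q} : x ↦ ψ_i(q,x)` are permutations of `X_i`. -/
def IsInvertible (A : Automaton X Q) : Prop :=
  ∀ (i : ℕ) (q : Q), Function.Bijective (A.out i q)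

/-- The labeling `σ_{i,q}` of an invertible automaton as a permutation of `X_i`. -/
noncomputable def labeling (A : Automaton X Q) (h : A.IsInvertible) (i : ℕ) (q : Q) :
    Equiv.Perm (X i) :=
  Equiv.ofBijective (A.out i q) (h i q)

/-- The inverse automaton:
`φ'_i(q,x) = φ_i(q, σ_{i,q}⁻¹(x))` and `ψ'_i(q,x) = σ_{i,q}⁻¹(x)`. -/
noncomputable def inverse (A : Automaton X Q) (h : A.IsInvertible) : Automaton X Q where
  trans i q x := A.trans i q ((A.labeling h i q).symm x)
  out i q x := (A.labeling h i q).symm x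

/-- `A` is reversible: every letter `x ∈ X_i` permutes the set of states by `q ↦ φ_i(q,x)`. -/
def IsReversible (A : Automaton X Q) : Prop :=
  ∀ (i : ℕ) (x : X i), Function.Bijective fun q : Q => A.trans i q x

/-- `A` is bi-reversible: it is invertible, and both `A` and its inverse are reversible. -/
def IsBiReversible (A : Automaton X Q) : Prop :=
  ∃ h : A.IsInvertible, A.IsReversible ∧ (A.inverse h).IsReversible

theorem inverse_stateAt_outWord (A : Automaton X Q) (h : A.IsInvertible) (q : Q) {t : ℕ}
    (w : (i : Fin t) → X i) (k : ℕ) (hk : k ≤ t) :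
    (A.inverse h).stateAt q (A.outWord q w) k hk = A.stateAt q w k hk := by
  induction k with
  | zero => rfl
  | succ k ih =>
    rw [stateAt, stateAt, ih]
    exact congrArg (A.trans k _)
      ((A.labeling h k (A.stateAt q w k (Nat.le_of_succ_le hk))).symm_apply_apply (w ⟨k, hk⟩))

theorem stateAt_inverse_outWord (A : Automaton X Q) (h : A.IsInvertible) (q : Q) {t : ℕ}
    (w : (i : Fin t) → X i) (k : ℕ) (hk : k ≤ t) :
    A.stateAt q ((A.inverse h).outWord q w) k hk = (A.inverse h).stateAt q w k hk := by
  induction k with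
  | zero => rfl
  | succ k ih =>
    rw [stateAt, stateAt, ih]
    rfl

theorem inverse_act_act (A : Automaton X Q) (h : A.IsInvertible) (q : Q) (w : WordTree X) :
    (A.inverse h).act q (A.act q w) = w := by
  obtain ⟨t, w⟩ := w
  refine Sigma.ext rfl (heq_of_eq (funext fun i : Fin t => ?_))
  change (A.inverse h).out i ((A.inverse h).stateAt q (A.outWord q w) i i.2.le) _ = w i
  rw [inverse_stateAt_outWord]
  exact (A.labeling h i (A.stateAt q w i i.2.le)).symm_apply_apply (w i)

theorem act_inverse_act (A : Automaton X Q) (h : A.IsInvertible) (q : Q) (w : WordTree X) :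
    A.act q ((A.inverse h).act q w) = w := by
  obtain ⟨t, w⟩ := w
  refine Sigma.ext rfl (heq_of_eq (funext fun i : Fin t => ?_))
  change A.out i (A.stateAt q ((A.inverse h).outWord q w) i i.2.le) _ = w i
  rw [stateAt_inverse_outWord]
  exact (A.labeling h i ((A.inverse h).stateAt q w i i.2.le)).apply_symm_apply (w i)

/-- `A_q` as a permutation of the tree `X^*`. -/
noncomputable def perm (A : Automaton X Q) (h : A.IsInvertible) (q : Q) :
    Equiv.Perm (WordTree X) where
  toFun := A.act q
  invFun := (A.inverse h).act q
  left_inv := A.inverse_act_act h q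
  right_inv := A.act_inverse_act h q

/-- The group `G(A) = ⟨A_q : q ∈ Q⟩` generated by an invertible automaton. -/
noncomputable def group (A : Automaton X Q) (h : A.IsInvertible) :
    Subgroup (Equiv.Perm (WordTree X)) :=
  Subgroup.closure (Set.range (A.perm h))

open Classical in
/-- For an injective sequence `ξ` of positions and an automaton `A` over `Y_j = X_{ξ_j}`, the
automaton over `X` which at a position `i = ξ_j` works as `A` at the position `j`, and which at
every position outside `Im ξ` keeps the state and the letter. -/
noncomputable def extend (ξ : ℕ → ℕ) (A : Automaton (fun j => X (ξ j)) Q) : Automaton X Q where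
  trans i q x :=
    if h : ∃ j, ξ j = i then A.trans h.choose q (cast (congrArg X h.choose_spec.symm) x) else q
  out i q x :=
    if h : ∃ j, ξ j = i then
      cast (congrArg X h.choose_spec) (A.out h.choose q (cast (congrArg X h.choose_spec.symm) x))
    else x

end Automaton

open Classical in
/-- Letters `x⁰_i, x¹_i ∈ Y_i`, a transposition `τ_i` and a long cycle `π_i` (a cyclic permutation
of the whole of `Y_i`) with `τ_i(x⁰_i) = π_i(x⁰_i) = x¹_i`, for every `i`. -/
structure SwapCycleChoice (Y : ℕ → Type u) where
  x₀ : (i : ℕ) → Y i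
  x₁ : (i : ℕ) → Y i
  τ : (i : ℕ) → Equiv.Perm (Y i)
  π : (i : ℕ) → Equiv.Perm (Y i)
  isSwap_τ : ∀ i, (τ i).IsSwap
  isCycleOn_π : ∀ i, (π i).IsCycleOn Set.univ
  τ_x₀ : ∀ i, τ i (x₀ i) = x₁ i
  π_x₀ : ∀ i, π i (x₀ i) = x₁ i

open Classical in
/-- The two-state automaton (state `0` is `q₁`, state `1` is `q₂`) which changes its state exactly
when it reads `x⁰_i`, and whose labelings are `π_i` in the state `q₁` and `τ_i` in `q₂`. -/
noncomputable def SwapCycleChoice.automaton {Y : ℕ → Type u} (c : SwapCycleChoice Y) :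
    Automaton Y (Fin 2) where
  trans i q x := if x = c.x₀ i then (if q = 0 then 1 else 0) else q
  out i q x := if q = 0 then c.π i x else c.τ i x

/-- `ξ` is strictly increasing, and the alphabet `Y_i = X_{ξ_i}` is unbounded with `|Y_i|`
non-decreasing and at least `2`. -/
structure IsAdmissibleSubsequence (X : ℕ → Type u) (ξ : ℕ → ℕ) : Prop where
  strictMono : StrictMono ξ
  unbounded : UnboundedAlphabet fun i => X (ξ i)
  monotone : Monotone fun i => Nat.card (X (ξ i))
  two_le : ∀ i, 2 ≤ Nat.card (X (ξ i))

/-! If a word in the generators and their inverses acts trivially on the tree, all its sections act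
trivially on letters. So freeness follows once every nonempty reduced word has a section that moves
a letter.

Sections keep the signs of a word and keep it reduced (`IsSwapLevel.isReduced_letterSection`).
Conversely, on levels whose nontrivial alphabets are large compared with the length, every reduced
word with the same signs occurs as a section (`exists_reach`). One of these is the special word:
`q₁` at one sign `e`, `q₂` at the other. Its factors of sign `e` act by one long cycle, the rest by
a transposition. A letter whose path along the cycle avoids the two transposed letters is only
rotated, and no state changes (`IsSwapLevel.letterSection_specialWord`). If `e` occurs in the word,
that letter is moved. -/

namespace Automaton

/-! ### Signed words of states and their sections -/

variable {X : ℕ → Type u} {Q : Type v} [Finite Q]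

/-- The automaton itself for the sign `true`, its inverse for the sign `false`. -/
noncomputable def signed (A : Automaton X Q) (h : A.IsInvertible) (b : Bool) : Automaton X Q :=
  cond b A (A.inverse h)

/-- The action of a signed word of states on a letter at level `i`; the last entry acts first. -/
noncomputable def apply (A : Automaton X Q) (h : A.IsInvertible) (i : ℕ) :
    List (Q × Bool) → X i → X i
  | [], x => x
  | a :: L, x => (A.signed h a.2).out i a.1 (apply A h i L x)

/-- The section of a signed word of states at a letter of level `i`. -/
noncomputable def letterSection (A : Automaton X Q) (h : A.IsInvertible) (i : ℕ) :
    List (Q × Bool) → X i → List (Q × Bool)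
  | [], _ => []
  | a :: L, x =>
    ((A.signed h a.2).trans i a.1 (A.apply h i L x), a.2) :: letterSection A h i L x

/-- The state reached after reading the first `k` letters of an infinite word. -/
def stateSeq (A : Automaton X Q) (q : Q) (u : (i : ℕ) → X i) : ℕ → Q
  | 0 => q
  | k + 1 => A.trans k (stateSeq A q u k) (u k)

/-- The section of a signed word of states at the first `k` letters of an infinite word. -/
noncomputable def sectionSeq (A : Automaton X Q) (h : A.IsInvertible) (L : List (Q × Bool))
    (u : (i : ℕ) → X i) : ℕ → List (Q × Bool)
  | 0 => L
  | k + 1 => A.letterSection h k (sectionSeq A h L u k) (u k)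

/-- The action of a signed word of states on an infinite word. -/
noncomputable def applySeq (A : Automaton X Q) (h : A.IsInvertible) (L : List (Q × Bool))
    (u : (i : ℕ) → X i) (i : ℕ) : X i :=
  A.apply h i (A.sectionSeq h L u i) (u i)

/-- The prefix of length `t` of an infinite word. -/
def wordPrefix (u : (i : ℕ) → X i) (t : ℕ) : WordTree X :=
  ⟨t, fun i => u i⟩

theorem stateAt_prefix (A : Automaton X Q) (q : Q) (u : (i : ℕ) → X i) (t k : ℕ) (hk : k ≤ t) :
    A.stateAt q (fun i : Fin t => u i) k hk = A.stateSeq q u k := by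
  induction k with
  | zero => rfl
  | succ k ih => rw [stateAt, stateSeq, ih]

theorem act_wordPrefix (A : Automaton X Q) (q : Q) (u : (i : ℕ) → X i) (t : ℕ) :
    A.act q (wordPrefix u t) = wordPrefix (fun i => A.out i (A.stateSeq q u i) (u i)) t := by
  refine Sigma.ext rfl (heq_of_eq (funext fun i : Fin t => ?_))
  change A.out i (A.stateAt q (fun i : Fin t => u i) i i.2.le) (u i) = _
  rw [stateAt_prefix]
  rfl

theorem sectionSeq_nil (A : Automaton X Q) (h : A.IsInvertible) (u : (i : ℕ) → X i) (k : ℕ) :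
    A.sectionSeq h [] u k = [] := by
  induction k with
  | zero => rfl
  | succ k ih => rw [sectionSeq, ih, letterSection]

theorem sectionSeq_cons (A : Automaton X Q) (h : A.IsInvertible) (a : Q × Bool)
    (L : List (Q × Bool)) (u : (i : ℕ) → X i) (k : ℕ) :
    A.sectionSeq h (a :: L) u k =
      ((A.signed h a.2).stateSeq a.1 (A.applySeq h L u) k, a.2) :: A.sectionSeq h L u k := by
  induction k with
  | zero => rfl
  | succ k ih => rw [sectionSeq, ih, letterSection]; rfl

/-- Links the free group to sections: the head of the list is the leftmost factor, so it acts on the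
output of the tail. -/
theorem lift_perm_mk_wordPrefix (A : Automaton X Q) (h : A.IsInvertible) (L : List (Q × Bool))
    (u : (i : ℕ) → X i) (t : ℕ) :
    FreeGroup.lift (A.perm h) (FreeGroup.mk L) (wordPrefix u t) =
      wordPrefix (A.applySeq h L u) t := by
  induction L with
  | nil =>
    have : A.applySeq h [] u = u := by
      funext i
      rw [applySeq, sectionSeq_nil, apply]
    rw [this]
    rfl
  | cons a L ih =>
    have key : A.applySeq h (a :: L) u = fun i => (A.signed h a.2).out i
        ((A.signed h a.2).stateSeq a.1 (A.applySeq h L u) i) (A.applySeq h L u i) := by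
      funext i
      rw [applySeq, sectionSeq_cons, apply]
      rfl
    rw [key, ← act_wordPrefix, ← ih]
    rw [FreeGroup.lift_mk, FreeGroup.lift_mk, List.map_cons, List.prod_cons, Equiv.Perm.mul_apply]
    obtain ⟨q, _ | _⟩ := a <;> rfl

/-- `A.Reach h i L j L'` means that `L'` is the section of `L` at some word of letters of
the levels `i, …, j - 1`. -/
inductive Reach (A : Automaton X Q) (h : A.IsInvertible) (i : ℕ) (L : List (Q × Bool)) :
    ℕ → List (Q × Bool) → Prop
  | refl : Reach A h i L i L
  | step {j : ℕ} {L' : List (Q × Bool)} (hr : Reach A h i L j L') (x : X j) :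
      Reach A h i L (j + 1) (A.letterSection h j L' x)

theorem Reach.le {A : Automaton X Q} {h : A.IsInvertible} {i j : ℕ} {L L' : List (Q × Bool)}
    (hr : A.Reach h i L j L') : i ≤ j := by
  induction hr with
  | refl => exact le_rfl
  | step _ _ ih => exact ih.trans (Nat.le_succ _)

theorem Reach.trans {A : Automaton X Q} {h : A.IsInvertible} {i j k : ℕ}
    {L L' L'' : List (Q × Bool)} (h₁ : A.Reach h i L j L') (h₂ : A.Reach h j L' k L'') :
    A.Reach h i L k L'' := by
  induction h₂ with
  | refl => exact h₁
  | step _ x ih => exact ih.step x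

theorem sectionSeq_congr (A : Automaton X Q) (h : A.IsInvertible) (L : List (Q × Bool))
    (u u' : (i : ℕ) → X i) (k : ℕ) (huu : ∀ i < k, u i = u' i) :
    A.sectionSeq h L u k = A.sectionSeq h L u' k := by
  induction k with
  | zero => rfl
  | succ k ih =>
    rw [sectionSeq, sectionSeq, ih fun i hi => huu i (hi.trans k.lt_succ_self),
      huu k k.lt_succ_self]

theorem Reach.exists_sectionSeq [∀ i, Nonempty (X i)] {A : Automaton X Q} {h : A.IsInvertible}
    {j : ℕ} {L L' : List (Q × Bool)} (hr : A.Reach h 0 L j L') :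
    ∃ u : (i : ℕ) → X i, A.sectionSeq h L u j = L' := by
  induction hr with
  | refl => exact ⟨fun _ => Classical.arbitrary _, rfl⟩
  | @step j L' _ x ih =>
    obtain ⟨u, hu⟩ := ih
    refine ⟨Function.update u j x, ?_⟩
    rw [sectionSeq, Function.update_self,
      A.sectionSeq_congr h L (Function.update u j x) u j
        fun i hi => Function.update_of_ne hi.ne _ _, hu]

/-- A signed word which acts trivially on the tree has only sections with trivial action on
letters. -/
theorem apply_eq_of_lift_eq_one [∀ i, Nonempty (X i)] {A : Automaton X Q} {h : A.IsInvertible}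
    {j : ℕ} {L L' : List (Q × Bool)} (hL : FreeGroup.lift (A.perm h) (FreeGroup.mk L) = 1)
    (hr : A.Reach h 0 L j L') (x : X j) : A.apply h j L' x = x := by
  obtain ⟨u, hu⟩ := hr.exists_sectionSeq
  -- The section after `j` letters ignores the letter at position `j`, which may therefore be
  -- replaced by `x`.
  have h₁ := A.lift_perm_mk_wordPrefix h L (Function.update u j x) (j + 1)
  rw [hL, Equiv.Perm.one_apply] at h₁
  have h₂ := congrFun (eq_of_heq (Sigma.mk.inj h₁).2) (Fin.last j)
  change Function.update u j x j = A.apply h j (A.sectionSeq h L (Function.update u j x) j)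
    (Function.update u j x j) at h₂
  rwa [Function.update_self,
    A.sectionSeq_congr h L (Function.update u j x) u j
      fun i hi => Function.update_of_ne hi.ne _ _, hu, eq_comm] at h₂

theorem map_snd_letterSection (A : Automaton X Q) (h : A.IsInvertible) (i : ℕ) (L : List (Q × Bool))
    (x : X i) : (A.letterSection h i L x).map Prod.snd = L.map Prod.snd := by
  induction L with
  | nil => rfl
  | cons a L ih => rw [letterSection, List.map_cons, List.map_cons, ih]

theorem Reach.map_snd {A : Automaton X Q} {h : A.IsInvertible} {i j : ℕ} {L L' : List (Q × Bool)}
    (hr : A.Reach h i L j L') : L'.map Prod.snd = L.map Prod.snd := by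
  induction hr with
  | refl => rfl
  | step _ x ih => rw [map_snd_letterSection, ih]

/-- At level `i` the automaton keeps the state and the letter. -/
structure IsIdLevel (A : Automaton X Q) (h : A.IsInvertible) (i : ℕ) : Prop where
  trans : ∀ b q x, (A.signed h b).trans i q x = q
  out : ∀ b q x, (A.signed h b).out i q x = x

theorem IsIdLevel.apply {A : Automaton X Q} {h : A.IsInvertible} {i : ℕ} (hi : A.IsIdLevel h i)
    (L : List (Q × Bool)) (x : X i) : A.apply h i L x = x := by
  induction L with
  | nil => rfl
  | cons a L ih => rw [Automaton.apply, ih, hi.out]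

theorem IsIdLevel.letterSection {A : Automaton X Q} {h : A.IsInvertible} {i : ℕ}
    (hi : A.IsIdLevel h i) (L : List (Q × Bool)) (x : X i) : A.letterSection h i L x = L := by
  induction L with
  | nil => rfl
  | cons a L ih => rw [Automaton.letterSection, ih, hi.trans]

open Classical in
/-- At level `i` the automaton with states `0`, `1` changes its state exactly when it reads
`t true` (and its inverse, when it reads `t false`); it acts by `ρ true` in the state `0`, where
the `ρ`-orbit is longer than `K`, and by a transposition in the state `1`. -/
structure IsSwapLevel (A : Automaton X (Fin 2)) (h : A.IsInvertible) (K i : ℕ)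
    (t : Bool → X i) (ρ : Bool → Equiv.Perm (X i)) : Prop where
  trans : ∀ b q x, (A.signed h b).trans i q x = if x = t b then q + 1 else q
  out_zero : ∀ b x, (A.signed h b).out i 0 x = ρ b x
  out_one : ∀ b x, (A.signed h b).out i 1 x = Equiv.swap (t b) (t !b) x
  map_t : ∀ b, ρ b (t b) = t !b
  pow_ne : ∀ b n, 0 < n → n ≤ K → (ρ b ^ n) (t b) ≠ t b

/-! ### Two-state automata: transitivity on reduced words and freeness -/

section TwoStates

variable {A : Automaton X (Fin 2)} {h : A.IsInvertible} {K i j : ℕ}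
  {t : Bool → X i} {ρ : Bool → Equiv.Perm (X i)}

theorem IsSwapLevel.out_eq_iff (hi : A.IsSwapLevel h K i t ρ) (b : Bool) (q : Fin 2) (x : X i) :
    (A.signed h b).out i q x = t (!b) ↔ x = t b := by
  classical
  match q with
  | 0 => rw [hi.out_zero, ← hi.map_t, EmbeddingLike.apply_eq_iff_eq]
  | 1 =>
    rw [hi.out_one]
    nth_rw 2 [← Equiv.swap_apply_left (t b) (t !b)]
    rw [EmbeddingLike.apply_eq_iff_eq]

/-- Of two neighbours with opposite signs, the right one changes its state exactly when it emits the
letter at which the left one changes its own. So both change or neither does, and distinct states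
stay distinct. -/
theorem IsSwapLevel.isReduced_letterSection (hi : A.IsSwapLevel h K i t ρ) {L : List (Fin 2 × Bool)}
    (hL : FreeGroup.IsReduced L) (x : X i) : FreeGroup.IsReduced (A.letterSection h i L x) := by
  classical
  induction L with
  | nil => exact hL
  | cons a L ih =>
    cases L with
    | nil => simp [letterSection]
    | cons c L =>
      rw [FreeGroup.isReduced_cons_cons] at hL
      rw [letterSection, letterSection, FreeGroup.isReduced_cons_cons]
      refine ⟨fun hac => ?_, ih hL.2⟩
      by_contra hne
      have hb : a.2 = !c.2 := by
        simpa [Bool.eq_not] using hne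
      dsimp only at hac
      rw [apply, hi.trans, hi.trans, hb] at hac
      simp only [hi.out_eq_iff] at hac
      refine hne (hL.1 ?_)
      split_ifs at hac
      · exact add_right_cancel hac
      · exact hac

theorem Reach.isReduced (hlev : ∀ i, A.IsIdLevel h i ∨ ∃ t ρ, A.IsSwapLevel h 0 i t ρ)
    {L L' : List (Fin 2 × Bool)} (hL : FreeGroup.IsReduced L) (hr : A.Reach h i L j L') :
    FreeGroup.IsReduced L' := by
  induction hr with
  | refl => exact hL
  | @step j L' _ x ih =>
    obtain hj | ⟨t, ρ, hj⟩ := hlev j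
    · rwa [hj.letterSection]
    · exact hj.isReduced_letterSection ih x

/-- The tail acts independently of the head, so along a fixed path each level flips or keeps the
state of the head, whatever that state is. -/
theorem Reach.exists_perm (hlev : ∀ i, A.IsIdLevel h i ∨ ∃ t ρ, A.IsSwapLevel h 0 i t ρ)
    {L L' : List (Fin 2 × Bool)} (hr : A.Reach h i L j L') (b : Bool) :
    ∃ f : Equiv.Perm (Fin 2), ∀ q, A.Reach h i ((q, b) :: L) j ((f q, b) :: L') := by
  classical
  induction hr with
  | refl => exact ⟨1, fun q => .refl⟩
  | @step j L' _ x ih =>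
    obtain ⟨f, hf⟩ := ih
    obtain hj | ⟨t, ρ, hj⟩ := hlev j
    · refine ⟨f, fun q => ?_⟩
      have := (hf q).step x
      rwa [Automaton.letterSection, hj.trans] at this
    · refine ⟨if A.apply h j L' x = t b then f.trans (Equiv.addRight 1) else f, fun q => ?_⟩
      have := (hf q).step x
      rw [Automaton.letterSection, hj.trans] at this
      convert this using 3
      dsimp only
      split_ifs <;> rfl

/-- The word with the same signs as `L` which has state `0` at the signs `e`, and state `1` at
the opposite signs. -/
def specialWord (e : Bool) (L : List (Fin 2 × Bool)) : List (Fin 2 × Bool) :=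
  L.map fun a => (if a.2 = e then 0 else 1, a.2)

theorem specialWord_cons (e : Bool) (a : Fin 2 × Bool) (L : List (Fin 2 × Bool)) :
    specialWord e (a :: L) = (if a.2 = e then 0 else 1, a.2) :: specialWord e L :=
  rfl

theorem map_snd_specialWord (e : Bool) (L : List (Fin 2 × Bool)) :
    (specialWord e L).map Prod.snd = L.map Prod.snd := by
  simp [specialWord]

theorem isReduced_specialWord (e : Bool) (L : List (Fin 2 × Bool)) :
    FreeGroup.IsReduced (specialWord e L) := by
  induction L with
  | nil => simp [specialWord]
  | cons a L ih =>
    cases L with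
    | nil => simp [specialWord]
    | cons c L =>
      rw [specialWord_cons, specialWord_cons, FreeGroup.isReduced_cons_cons]
      refine ⟨fun hac => ?_, ih⟩
      obtain ⟨_, _ | _⟩ := a <;> obtain ⟨_, _ | _⟩ := c <;> cases e <;> simp_all

/-- The number of occurrences of the sign `e`. -/
def signCount (e : Bool) (L : List (Fin 2 × Bool)) : ℕ :=
  L.countP fun a => a.2 = e

/-- The letter starts `signCount e L + d` steps before `t e` on its `ρ e`-orbit, and each factor of
sign `e` advances it one step. It stops `d > 0` steps short, so it meets neither `t e` nor `t (!e)`,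
the letter one step past `t e`; hence no transposition moves it and no state changes. -/
theorem IsSwapLevel.letterSection_specialWord (hi : A.IsSwapLevel h K i t ρ) (e : Bool)
    (L : List (Fin 2 × Bool)) (d : ℕ) (hd : 0 < d) (hK : signCount e L + d + 1 ≤ K) (x : X i)
    (hx : (ρ e ^ (signCount e L + d)) x = t e) :
    A.letterSection h i (specialWord e L) x = specialWord e L ∧
      (ρ e ^ d) (A.apply h i (specialWord e L) x) = t e := by
  classical
  induction L generalizing d with
  | nil => exact ⟨rfl, by simpa [signCount, specialWord, apply] using hx⟩
  | cons a L ih =>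
    rw [specialWord_cons, letterSection, apply, hi.trans]
    by_cases ha : a.2 = e
    · have hc : signCount e (a :: L) = signCount e L + 1 := by simp [signCount, ha]
      rw [hc, add_assoc, add_comm 1 d] at hx
      -- The tail has to leave `d + 1` steps, as the head uses one.
      obtain ⟨h₁, h₂⟩ := ih (d + 1) d.succ_pos (by omega) hx
      have hne : A.apply h i (specialWord e L) x ≠ t e := fun h₀ => by
        rw [h₀] at h₂
        exact hi.pow_ne e (d + 1) d.succ_pos (by omega) h₂
      simp only [ha, if_true, hne, if_false, h₁, hi.out_zero, true_and]
      rwa [pow_succ, Equiv.Perm.mul_apply] at h₂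
    · have hc : signCount e (a :: L) = signCount e L := by simp [signCount, ha]
      rw [hc] at hx
      obtain ⟨h₁, h₂⟩ := ih d hd (by omega) hx
      have hae : a.2 = !e := by simpa [Bool.eq_not] using ha
      have hne : A.apply h i (specialWord e L) x ≠ t e := fun h₀ => by
        rw [h₀] at h₂
        exact hi.pow_ne e d hd (by omega) h₂
      -- At `t (!e) = ρ e (t e)` the orbit would return to `t e` after `d + 1` steps; this is why
      -- `hK` contains `+ 1`.
      have hne' : A.apply h i (specialWord e L) x ≠ t (!e) := fun h₀ => by
        rw [h₀, ← hi.map_t, ← Equiv.Perm.mul_apply, ← pow_succ] at h₂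
        exact hi.pow_ne e (d + 1) d.succ_pos (by omega) h₂
      have hee : ¬ (!e) = e := by simp
      simp only [hae, hne', hee, if_false, h₁, hi.out_one, true_and, Bool.not_not]
      rwa [Equiv.swap_apply_of_ne_of_ne hne' hne]

theorem IsSwapLevel.exists_letterSection_specialWord (hi : A.IsSwapLevel h K i t ρ) (e : Bool)
    (L : List (Fin 2 × Bool)) (hK : signCount e L + 2 ≤ K) :
    ∃ x, A.letterSection h i (specialWord e L) x = specialWord e L ∧
      A.apply h i (specialWord e L) x ≠ t e := by
  obtain ⟨h₁, h₂⟩ := hi.letterSection_specialWord e L 1 one_pos (by omega)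
    ((ρ e ^ (signCount e L + 1))⁻¹ (t e)) (Equiv.apply_symm_apply _ _)
  refine ⟨_, h₁, fun h₀ => ?_⟩
  rw [h₀] at h₂
  exact hi.pow_ne e 1 one_pos (by omega) h₂

/-- If the head has sign `e`, the letter may end on `t e` itself: the head reads the letter one step
before. A factor of sign `e` prepended to the word then changes its state, while the word itself
does not change. -/
theorem IsSwapLevel.exists_letterSection_specialWord_apply_eq (hi : A.IsSwapLevel h K i t ρ) (e : Bool)
    (L : List (Fin 2 × Bool)) (hL : ∀ a ∈ L.head?, a.2 = e) (hK : signCount e L + 2 ≤ K) :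
    ∃ x, A.letterSection h i (specialWord e L) x = specialWord e L ∧
      A.apply h i (specialWord e L) x = t e := by
  cases L with
  | nil => exact ⟨t e, rfl, rfl⟩
  | cons a L =>
    have ha : a.2 = e := hL a rfl
    have hc : signCount e (a :: L) = signCount e L + 1 := by simp [signCount, ha]
    obtain ⟨h₁, h₂⟩ := hi.letterSection_specialWord e L 1 one_pos (by omega)
      ((ρ e ^ (signCount e L + 1))⁻¹ (t e)) (Equiv.apply_symm_apply _ _)
    refine ⟨(ρ e ^ (signCount e L + 1))⁻¹ (t e), ?_, ?_⟩
    rotate_left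
    · rw [specialWord_cons, apply, ha, if_pos rfl, hi.out_zero]
      simpa using h₂
    · rw [specialWord_cons, letterSection, ha, if_pos rfl, h₁, hi.trans, if_neg]
      intro h₀
      rw [h₀] at h₂
      exact hi.pow_ne e 1 one_pos (by omega) h₂

theorem reach_specialWord [∀ i, Nonempty (X i)] {i₀ : ℕ}
    (hlev : ∀ i, i₀ ≤ i → A.IsIdLevel h i ∨ ∃ t ρ, A.IsSwapLevel h K i t ρ) (e : Bool)
    (L : List (Fin 2 × Bool)) (hK : signCount e L + 2 ≤ K) (hi : i₀ ≤ i) (hij : i ≤ j) :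
    A.Reach h i (specialWord e L) j (specialWord e L) := by
  induction j, hij using Nat.le_induction with
  | base => exact .refl
  | succ j hij ih =>
    obtain hj | ⟨t, ρ, hj⟩ := hlev j (hi.trans hij)
    · have := ih.step (Classical.arbitrary (X j))
      rwa [hj.letterSection] at this
    · obtain ⟨x, hx, -⟩ := hj.exists_letterSection_specialWord e L hK
      have := ih.step x
      rwa [hx] at this

theorem signCount_le_length (e : Bool) (L : List (Fin 2 × Bool)) : signCount e L ≤ L.length :=
  List.countP_le_length

/-- Over sufficiently deep levels, sections act transitively on the reduced words with given
signs. -/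
theorem exists_reach [∀ i, Nonempty (X i)] {i₀ : ℕ}
    (hlev₀ : ∀ i, A.IsIdLevel h i ∨ ∃ t ρ, A.IsSwapLevel h 0 i t ρ)
    (hlev : ∀ i, i₀ ≤ i → A.IsIdLevel h i ∨ ∃ t ρ, A.IsSwapLevel h K i t ρ)
    (hswap : ∀ n, ∃ i, n ≤ i ∧ ∃ t ρ, A.IsSwapLevel h K i t ρ)
    (L L' : List (Fin 2 × Bool)) (hL : FreeGroup.IsReduced L) (hL' : FreeGroup.IsReduced L')
    (hLL : L.map Prod.snd = L'.map Prod.snd) (hK : L.length + 2 ≤ K) (hi : i₀ ≤ i) :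
    ∃ j, A.Reach h i L j L' := by
  induction hn : L.length generalizing L L' i with
  | zero =>
    obtain rfl := List.length_eq_zero_iff.1 hn
    obtain rfl : L' = [] := by simpa using hLL.symm
    exact ⟨i, .refl⟩
  | succ n ih =>
    obtain _ | ⟨⟨q, b⟩, L⟩ := L
    · simp at hn
    obtain _ | ⟨⟨q', b'⟩, L'⟩ := L'
    · simp at hLL
    simp only [List.map_cons, List.cons.injEq] at hLL
    obtain ⟨rfl, hLL⟩ := hLL
    rw [List.length_cons] at hK hn
    have hLr : FreeGroup.IsReduced L := List.IsChain.tail hL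
    have hLr' : FreeGroup.IsReduced L' := List.IsChain.tail hL'
    by_cases hb : ∀ c ∈ L.head?, c.2 = b
    · have hc := signCount_le_length b L
      obtain ⟨j₁, h₁⟩ := ih L (specialWord b L) hLr (isReduced_specialWord b L)
        (map_snd_specialWord b L).symm (by omega) hi (by omega)
      obtain ⟨j₂, hj₂, t, ρ, hs⟩ := hswap j₁
      have h₂ := h₁.trans (reach_specialWord hlev b L (by omega) (hi.trans h₁.le) hj₂)
      obtain ⟨f, hf⟩ := h₂.exists_perm hlev₀ b
      have hlen : (specialWord b L).length = L.length := List.length_map _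
      obtain ⟨j₃, h₃⟩ := ih (specialWord b L) L' (isReduced_specialWord b L) hLr'
        ((map_snd_specialWord b L).trans hLL) (by omega)
        ((hi.trans h₂.le).trans (Nat.le_succ _)) (by omega)
      obtain ⟨g, hg⟩ := h₃.exists_perm hlev₀ b
      refine ⟨j₃, ?_⟩
      -- `g` is the effect of the last stage on the head, so a flip beforehand is needed exactly
      -- when `g (f q)` misses `q'`.
      by_cases hq : g (f q) = q'
      · obtain ⟨x, hx, hxt⟩ := hs.exists_letterSection_specialWord b L (by omega)
        have h₄ := (hf q).step x
        rw [letterSection, hx, hs.trans, if_neg hxt] at h₄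
        rw [← hq]
        exact h₄.trans (hg (f q))
      · obtain ⟨x, hx, hxt⟩ := hs.exists_letterSection_specialWord_apply_eq b L hb (by omega)
        have h₄ := (hf q).step x
        rw [letterSection, hx, hs.trans, if_pos hxt] at h₄
        have hne : g (f q + 1) ≠ g (f q) := fun h₀ => by
          have := g.injective h₀
          omega
        obtain rfl : g (f q + 1) = q' := by omega
        exact h₄.trans (hg (f q + 1))
    -- With opposite signs, reducedness makes the head differ from its neighbour, and with two
    -- states this determines it.
    · push Not at hb
      obtain ⟨c, hc, hcb⟩ := hb
      obtain ⟨j, hj⟩ := ih L L' hLr hLr' hLL (by omega) hi (by omega)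
      obtain ⟨f, hf⟩ := hj.exists_perm hlev₀ b
      refine ⟨j, ?_⟩
      have h₁ := hf q
      have h₂ := h₁.isReduced hlev₀ hL
      obtain _ | ⟨c, L⟩ := L
      · simp at hc
      obtain _ | ⟨c', L'⟩ := L'
      · simp at hLL
      rw [FreeGroup.isReduced_cons_cons] at h₂ hL'
      simp only [List.map_cons, List.cons.injEq] at hLL
      simp only [List.head?_cons, Option.mem_def, Option.some.injEq] at hc
      subst hc
      have hne : ¬ b = c'.2 := fun h₀ => hcb (by rw [hLL.1, h₀])
      have e₁ : f q ≠ c'.1 := fun h₀ => hne (h₂.1 h₀)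
      have e₂ : q' ≠ c'.1 := fun h₀ => hne (hL'.1 h₀)
      obtain rfl : f q = q' := by omega
      exact h₁

/-- Two-state automata with infinitely many swap levels, whose `ρ`-orbits become arbitrarily long,
generate a free group. -/
theorem injective_lift_perm [∀ i, Nonempty (X i)]
    (hlev₀ : ∀ i, A.IsIdLevel h i ∨ ∃ t ρ, A.IsSwapLevel h 0 i t ρ)
    (hlev : ∀ K, ∃ i₀, ∀ i, i₀ ≤ i → A.IsIdLevel h i ∨ ∃ t ρ, A.IsSwapLevel h K i t ρ)
    (hswap : ∀ K n, ∃ i, n ≤ i ∧ ∃ t ρ, A.IsSwapLevel h K i t ρ) :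
    Function.Injective (FreeGroup.lift (A.perm h)) := by
  rw [injective_iff_map_eq_one]
  intro g hg
  by_contra hg₁
  have hred := FreeGroup.isReduced_toWord (x := g)
  have hne : g.toWord ≠ [] := fun h₀ => hg₁ (FreeGroup.toWord_eq_nil_iff.1 h₀)
  rw [← FreeGroup.mk_toWord (x := g)] at hg
  generalize g.toWord = L at hg hred hne
  -- At most `L.length` rotation steps, plus `d = 1`, plus the step from `t e` to `t (!e)`.
  obtain ⟨i₀, hi₀⟩ := hlev (L.length + 2)
  have h₁ : ∀ n, ∃ L', A.Reach h 0 L n L' := fun n => by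
    induction n with
    | zero => exact ⟨L, .refl⟩
    | succ n ih =>
      obtain ⟨L', hL'⟩ := ih
      exact ⟨_, hL'.step (Classical.arbitrary (X n))⟩
  obtain ⟨L₁, hL₁⟩ := h₁ i₀
  have hs := hL₁.map_snd
  have hlen : L₁.length = L.length := by simpa using congrArg List.length hs
  obtain _ | ⟨a, L₂⟩ := L₁
  · exact hne (List.length_eq_zero_iff.1 hlen.symm)
  obtain ⟨j, hj⟩ := exists_reach hlev₀ hi₀ (hswap _) (a :: L₂) (specialWord a.2 (a :: L₂))
    (hL₁.isReduced hlev₀ hred) (isReduced_specialWord _ _) (map_snd_specialWord _ _).symm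
    (by omega) le_rfl
  obtain ⟨k, hk, t, ρ, hsw⟩ := hswap (L.length + 2) j
  have hc := signCount_le_length a.2 (a :: L₂)
  have hpos : 0 < signCount a.2 (a :: L₂) := by simp [signCount]
  have hreach := (hL₁.trans hj).trans
    (reach_specialWord hi₀ a.2 (a :: L₂) (by omega) hj.le hk)
  generalize hm : signCount a.2 (a :: L₂) = m at hc hpos
  -- The special word advances this letter by `m` steps. If it also fixed the letter, `ρ a.2 ^ m`
  -- would fix `t a.2`.
  have hx : (ρ a.2 ^ (m + 1)) ((ρ a.2 ^ (m + 1))⁻¹ (t a.2)) = t a.2 := Equiv.apply_symm_apply _ _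
  generalize (ρ a.2 ^ (m + 1))⁻¹ (t a.2) = x at hx
  obtain ⟨-, h₂⟩ := hsw.letterSection_specialWord a.2 (a :: L₂) 1 one_pos (by omega) x (by rwa [hm])
  rw [apply_eq_of_lift_eq_one hg hreach, pow_one] at h₂
  rw [pow_succ, Equiv.Perm.mul_apply, h₂] at hx
  exact hsw.pow_ne _ m hpos (by omega) hx

end TwoStates

end Automaton

/-! ### Existence of the subsequence, letters and permutations -/

theorem exists_isAdmissibleSubsequence (X : ℕ → Type u) (hX : UnboundedAlphabet X) :
    ∃ ξ : ℕ → ℕ, IsAdmissibleSubsequence X ξ := by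
  have hbig : ∀ M, ∃ n, M < Nat.card (X n) := fun M => by
    by_contra! h₀
    exact hX ⟨M, by rintro _ ⟨i, rfl⟩; exact h₀ i⟩
  obtain ⟨ξ, hξ, hP⟩ := Nat.exists_strictMono_subsequence
    (P := fun n => 2 ≤ Nat.card (X n) ∧ ∀ m < n, Nat.card (X m) < Nat.card (X n)) fun N => by
      -- The first index whose size exceeds this bound lies beyond `N` and is a strict record; the
      -- `+ 1` makes the size at least `2`.
      have hex := hbig (∑ i ∈ Finset.range (N + 1), Nat.card (X i) + 1)
      classical
      have hle : ∀ m ≤ N, Nat.card (X m) ≤ ∑ i ∈ Finset.range (N + 1), Nat.card (X i) :=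
        fun m hm => Finset.single_le_sum (f := fun i => Nat.card (X i))
          (fun _ _ => Nat.zero_le _) (Finset.mem_range.2 (by omega))
      have hspec := Nat.find_spec hex
      refine ⟨Nat.find hex, ?_, by omega, fun m hm => ?_⟩
      · by_contra! h₀
        have := hle _ h₀
        omega
      · have := Nat.find_min hex hm
        omega
  have hmono : StrictMono fun i => Nat.card (X (ξ i)) := fun i j hij => (hP j).2 _ (hξ hij)
  refine ⟨ξ, hξ, ?_, hmono.monotone, fun i => (hP i).1⟩
  rintro ⟨M, hM⟩
  have h₁ := hM ⟨M + 1, rfl⟩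
  have h₂ := hmono.le_apply (x := M + 1)
  dsimp only at h₁
  omega

theorem nonempty_swapCycleChoice (Y : ℕ → Type u) [∀ i, Finite (Y i)]
    (hY : ∀ i, 2 ≤ Nat.card (Y i)) : Nonempty (SwapCycleChoice Y) := by
  classical
  have key : ∀ i, ∃ π : Equiv.Perm (Y i), π.IsCycleOn Set.univ := fun i => by
    obtain ⟨π, hπ, -⟩ := (Set.to_countable (Set.univ : Set (Y i))).exists_cycleOn
    exact ⟨π, hπ⟩
  choose π hπ using key
  have hnt : ∀ i, Nontrivial (Y i) := fun i => Finite.one_lt_card_iff_nontrivial.1 (hY i)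
  refine ⟨⟨fun i => Classical.arbitrary _, fun i => π i (Classical.arbitrary _),
    fun i => Equiv.swap (Classical.arbitrary _) (π i (Classical.arbitrary _)), π,
    fun i => ⟨_, _, ?_, by congr⟩, hπ, fun i => ?_, fun _ => rfl⟩⟩
  · exact ((hπ i).apply_ne Set.nontrivial_univ (Set.mem_univ _)).symm
  · convert Equiv.swap_apply_left _ _

/-! ### Extension of an automaton by identity levels -/

namespace Automaton

variable {X : ℕ → Type u} {Q : Type v} [Finite Q]

theorem extend_trans (ξ : ℕ → ℕ) (hξ : Function.Injective ξ) (A : Automaton (fun j => X (ξ j)) Q)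
    (j : ℕ) (q : Q) (x : X (ξ j)) : (extend ξ A).trans (ξ j) q x = A.trans j q x := by
  have hj : ∃ j', ξ j' = ξ j := ⟨j, rfl⟩
  -- For a variable `k`, injectivity of `ξ` gives `k = j` and the casts disappear.
  have key : ∀ (k : ℕ) (hk : ξ k = ξ j),
      A.trans k q (cast (congrArg X hk.symm) x) = A.trans j q x := fun k hk => by
    obtain rfl := hξ hk
    rfl
  exact (dif_pos hj).trans (key _ hj.choose_spec)

theorem extend_out (ξ : ℕ → ℕ) (hξ : Function.Injective ξ) (A : Automaton (fun j => X (ξ j)) Q)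
    (j : ℕ) (q : Q) (x : X (ξ j)) : (extend ξ A).out (ξ j) q x = A.out j q x := by
  have hj : ∃ j', ξ j' = ξ j := ⟨j, rfl⟩
  have key : ∀ (k : ℕ) (hk : ξ k = ξ j),
      cast (congrArg X hk) (A.out k q (cast (congrArg X hk.symm) x)) = A.out j q x :=
    fun k hk => by
      obtain rfl := hξ hk
      rfl
  exact (dif_pos hj).trans (key _ hj.choose_spec)

theorem extend_trans_of_forall_ne (ξ : ℕ → ℕ) (A : Automaton (fun j => X (ξ j)) Q) {i : ℕ}
    (hi : ¬ ∃ j, ξ j = i) (q : Q) (x : X i) : (extend ξ A).trans i q x = q :=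
  dif_neg hi

theorem extend_out_of_forall_ne (ξ : ℕ → ℕ) (A : Automaton (fun j => X (ξ j)) Q) {i : ℕ}
    (hi : ¬ ∃ j, ξ j = i) (q : Q) (x : X i) : (extend ξ A).out i q x = x :=
  dif_neg hi

theorem isInvertible_extend (ξ : ℕ → ℕ) (hξ : Function.Injective ξ)
    {A : Automaton (fun j => X (ξ j)) Q} (hA : A.IsInvertible) : (extend ξ A).IsInvertible := by
  intro i q
  by_cases hi : ∃ j, ξ j = i
  · obtain ⟨j, rfl⟩ := hi
    rw [show (extend ξ A).out (ξ j) q = A.out j q from funext (extend_out ξ hξ A j q)]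
    exact hA j q
  · rw [show (extend ξ A).out i q = id from funext (extend_out_of_forall_ne ξ A hi q)]
    exact Function.bijective_id

theorem out_inverse_out (A : Automaton X Q) (h : A.IsInvertible) (i : ℕ) (q : Q) (x : X i) :
    A.out i q ((A.inverse h).out i q x) = x :=
  (A.labeling h i q).apply_symm_apply x

theorem isIdLevel_extend (ξ : ℕ → ℕ) (A : Automaton (fun j => X (ξ j)) Q)
    (h : (extend ξ A).IsInvertible) {i : ℕ} (hi : ¬ ∃ j, ξ j = i) :
    (extend ξ A).IsIdLevel h i where
  trans b q x := by
    cases b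
    · exact extend_trans_of_forall_ne ξ A hi _ _
    · exact extend_trans_of_forall_ne ξ A hi _ _
  out b q x := by
    cases b
    · have := out_inverse_out _ h i q x
      rwa [extend_out_of_forall_ne ξ A hi] at this
    · exact extend_out_of_forall_ne ξ A hi _ _

/-- An automaton is bi-reversible if it and its inverse permute the states at every level. -/
theorem isBiReversible_of_levels {A : Automaton X (Fin 2)} (h : A.IsInvertible)
    (hlev : ∀ i, A.IsIdLevel h i ∨ ∃ t ρ, A.IsSwapLevel h 0 i t ρ) : A.IsBiReversible := by
  have key : ∀ b, (A.signed h b).IsReversible := fun b i x => by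
    obtain hi | ⟨t, ρ, hi⟩ := hlev i
    · simp only [hi.trans]
      exact Function.bijective_id
    · simp only [hi.trans]
      split_ifs
      · exact (Equiv.addRight (1 : Fin 2)).bijective
      · exact Function.bijective_id
  exact ⟨h, key true, key false⟩

end Automaton

/-! ### The given automaton has swap levels -/

namespace SwapCycleChoice

variable {Y : ℕ → Type u} (c : SwapCycleChoice Y)

theorem isInvertible_automaton : c.automaton.IsInvertible := by
  intro i q
  by_cases hq : q = 0
  · rw [show c.automaton.out i q = c.π i from funext fun x => if_pos hq]
    exact (c.π i).bijective
  · rw [show c.automaton.out i q = c.τ i from funext fun x => if_neg hq]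
    exact (c.τ i).bijective

open Classical in
theorem τ_eq_swap (i : ℕ) : c.τ i = Equiv.swap (c.x₀ i) (c.x₁ i) := by
  obtain ⟨a, b, hab, hs⟩ := c.isSwap_τ i
  have hne : c.τ i (c.x₀ i) ≠ c.x₀ i := by
    rw [c.τ_x₀, ← c.π_x₀]
    exact (c.isCycleOn_π i).apply_ne ⟨a, trivial, b, trivial, hab⟩ (Set.mem_univ _)
  rw [← c.τ_x₀]
  rw [hs] at hne ⊢
  obtain h₀ | h₀ : c.x₀ i = a ∨ c.x₀ i = b := by
    by_contra! h₀
    exact hne (Equiv.swap_apply_of_ne_of_ne h₀.1 h₀.2)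
  · rw [h₀, Equiv.swap_apply_left]
  · rw [h₀, Equiv.swap_apply_right, Equiv.swap_comm]

theorem π_pow_ne [∀ i, Finite (Y i)] (i n : ℕ) (hn : 0 < n) (hcard : n < Nat.card (Y i))
    (x : Y i) : (c.π i ^ n) x ≠ x := by
  have := Fintype.ofFinite (Y i)
  have hcyc : (c.π i).IsCycleOn (Finset.univ : Finset (Y i)) := by
    simpa using c.isCycleOn_π i
  rw [Ne, hcyc.pow_apply_eq (Finset.mem_univ x), Finset.card_univ, ← Nat.card_eq_fintype_card]
  exact Nat.not_dvd_of_pos_of_lt hn hcard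

end SwapCycleChoice

namespace Automaton

variable {X : ℕ → Type u}

-- Both labelings send `x₀` to `x₁`, so the inverse automaton changes its state exactly at `x₁`,
-- with labelings `π⁻¹` and the same transposition. Reversing the sign thus only exchanges `x₀` with
-- `x₁` and `π` with `π⁻¹`.
open Classical in
theorem isSwapLevel_of_eq {A : Automaton X (Fin 2)} (h : A.IsInvertible) {K i : ℕ} {x₀ x₁ : X i}
    {π : Equiv.Perm (X i)} (htrans : ∀ q x, A.trans i q x = if x = x₀ then q + 1 else q)
    (h₀ : ∀ x, A.out i 0 x = π x) (h₁ : ∀ x, A.out i 1 x = Equiv.swap x₀ x₁ x)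
    (hπ : π x₀ = x₁) (hpow : ∀ n x, 0 < n → n ≤ K → (π ^ n) x ≠ x) :
    A.IsSwapLevel h K i (fun b => cond b x₀ x₁) (fun b => cond b π π⁻¹) := by
  have hinv := A.out_inverse_out h i
  have hout : ∀ q, A.out i q x₀ = x₁ := fun q => by
    match q with
    | 0 => rw [h₀, hπ]
    | 1 => rw [h₁, Equiv.swap_apply_left]
  refine ⟨fun b q x => ?_, fun b x => ?_, fun b x => ?_, fun b => ?_, fun b n hn hK => ?_⟩
  · cases b
    · change A.trans i q ((A.inverse h).out i q x) = if x = x₁ then q + 1 else q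
      rw [htrans]
      congr 1
      rw [← (h i q).injective.eq_iff, hinv, hout]
    · exact htrans q x
  · cases b
    · change (A.inverse h).out i 0 x = π⁻¹ x
      rw [Equiv.Perm.eq_inv_iff_eq, ← h₀, hinv]
    · exact h₀ x
  · cases b
    · change (A.inverse h).out i 1 x = Equiv.swap x₁ x₀ x
      rw [← (h i 1).injective.eq_iff, hinv, h₁, Equiv.swap_comm x₁ x₀, Equiv.swap_apply_self]
    · exact h₁ x
  · cases b
    · exact Equiv.Perm.inv_eq_iff_eq.2 hπ.symm
    · exact hπ
  · cases b
    · change (π⁻¹ ^ n) x₁ ≠ x₁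
      rw [inv_pow, Ne, Equiv.Perm.inv_eq_iff_eq]
      exact (hpow n x₁ hn hK).symm
    · exact hpow n x₀ hn hK

theorem isSwapLevel_extend_automaton [∀ i, Finite (X i)] {ξ : ℕ → ℕ} (hξ : Function.Injective ξ)
    (c : SwapCycleChoice fun i => X (ξ i)) (h : (extend ξ c.automaton).IsInvertible) {K j : ℕ}
    (hK : K < Nat.card (X (ξ j))) :
    ∃ t ρ, (extend ξ c.automaton).IsSwapLevel h K (ξ j) t ρ := by
  classical
  refine ⟨_, _, isSwapLevel_of_eq (x₀ := c.x₀ j) (x₁ := c.x₁ j) (π := c.π j) h (fun q x => ?_)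
    (fun x => ?_) (fun x => ?_) (c.π_x₀ j)
    fun n x hn hnK => c.π_pow_ne j n hn (hnK.trans_lt hK) x⟩
  · rw [extend_trans ξ hξ]
    change (if x = c.x₀ j then (if q = 0 then 1 else 0) else q) = _
    congr 1
    revert q
    decide
  · rw [extend_out ξ hξ]
    rfl
  · rw [extend_out ξ hξ]
    change c.τ j x = _
    rw [c.τ_eq_swap]

end Automaton

/-! ### The main theorem -/

theorem mainTheorem2 (X : ℕ → Type u) [∀ i, Finite (X i)] [∀ i, Nonempty (X i)]
    (hX : UnboundedAlphabet X) :
    (∃ ξ : ℕ → ℕ, IsAdmissibleSubsequence X ξ) ∧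
    ∀ ξ : ℕ → ℕ, IsAdmissibleSubsequence X ξ →
      Nonempty (SwapCycleChoice fun i => X (ξ i)) ∧
      ∀ c : SwapCycleChoice fun i => X (ξ i),
        (Automaton.extend ξ c.automaton).IsBiReversible ∧
        ∃ h : (Automaton.extend ξ c.automaton).IsInvertible,
          Nonempty ((Automaton.extend ξ c.automaton).group h ≃* FreeGroup (Fin 2)) := by
  refine ⟨exists_isAdmissibleSubsequence X hX, fun ξ hξ =>
    ⟨nonempty_swapCycleChoice _ hξ.two_le, fun c => ?_⟩⟩
  have hinj := hξ.strictMono.injective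
  have h := Automaton.isInvertible_extend ξ hinj c.isInvertible_automaton
  have hlarge : ∀ K, ∃ j₀, ∀ j, j₀ ≤ j → K < Nat.card (X (ξ j)) := fun K => by
    by_contra! h₀
    refine hξ.unbounded ⟨K, ?_⟩
    rintro _ ⟨j₀, rfl⟩
    obtain ⟨j, hj, hK⟩ := h₀ j₀
    exact (hξ.monotone hj).trans hK
  have hlev₀ : ∀ i, (Automaton.extend ξ c.automaton).IsIdLevel h i ∨
      ∃ t ρ, (Automaton.extend ξ c.automaton).IsSwapLevel h 0 i t ρ := fun i => by
    by_cases hi : ∃ j, ξ j = i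
    · obtain ⟨j, rfl⟩ := hi
      exact .inr (Automaton.isSwapLevel_extend_automaton hinj c h
        (zero_lt_two.trans_le (hξ.two_le j)))
    · exact .inl (Automaton.isIdLevel_extend ξ _ h hi)
  refine ⟨Automaton.isBiReversible_of_levels h hlev₀, h, ?_⟩
  have hfree := Automaton.injective_lift_perm hlev₀ (fun K => ?_) fun K n => ?_
  · exact ⟨((MonoidHom.ofInjective hfree).trans
      (MulEquiv.subgroupCongr (FreeGroup.range_lift_eq_closure))).symm⟩
  · obtain ⟨j₀, hj₀⟩ := hlarge K
    refine ⟨ξ j₀, fun i hij => ?_⟩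
    by_cases hi : ∃ j, ξ j = i
    · obtain ⟨j, rfl⟩ := hi
      exact .inr (Automaton.isSwapLevel_extend_automaton hinj c h
        (hj₀ j (hξ.strictMono.le_iff_le.1 hij)))
    · exact .inl (Automaton.isIdLevel_extend ξ _ h hi)
  · obtain ⟨j₀, hj₀⟩ := hlarge K
    exact ⟨ξ (max j₀ n), (le_max_right _ _).trans hξ.strictMono.le_apply,
      Automaton.isSwapLevel_extend_automaton hinj c h (hj₀ _ (le_max_left _ _))⟩
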